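/- Let $1\le k\le n$ be integers. A partition of $[0,1]$ into $k$ intervals (intervals of length zero are allowed) is identified with the vector $x=(x_1,\dots,x_k)\in\Delta^{k-1}$ of the lengths of its pieces, from left to right. The preferences of a guest are given by sets $A_1,\dots,A_k\subseteq\Delta^{k-1}$: the guest prefers the $j$-th piece of $x$ (it is one of their favorite pieces) if $x\in A_j$; in a given partition a guest may have several favorite pieces, or none. A guest is hungry if in every partition they prefer some piece of positive length. We say that $n$ guests are $k$-hungry if, for every partition of $[0,1]$ into $k$ intervals and any $n-k+1$ of the guests, at least one of these guests prefers a piece of positive length, and if all sets $A_j$ of every guest are closed. Consider $n$ guests, one of whom is Alice, and let the preferences of the $n-1$ other guests be given. Then there is a partition $x$ of $[0,1]$ into $k$ intervals, depending only on the preferences of the other guests, with the following property. Whatever the preferences of Alice are, as long as Alice is hungry and the $n$ guests are $k$-hungry, and whichever piece $j$ of $x$ Alice prefers, the $k$ pieces of $x$ can be distributed to $k$ different guests, namely Alice and $k-1$ of the others, so that each of them receives a piece of $x$ that they prefer and Alice receives the piece $j$. -/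

import Mathlib

namespace SecretCake

/-- A partition of the cake `[0,1]` into `k` consecutive intervals (length zero is allowed), recorded
by the vector of lengths of its pieces from left to right: a point of the standard simplex. Piece `j`
of `x` is the interval from `∑ l < j, x l` to `∑ l ≤ j, x l`, and has length `x j`. -/
abbrev CakePartition (k : ℕ) : Type := stdSimplex ℝ (Fin k)

/-- The preferences of one guest: `A j` is the set of the partitions in which the `j`-th piece is one
of the guest's favorite pieces. There may be several favorites in a partition, or none at all. -/
abbrev Preferences (k : ℕ) : Type := Fin k → Set (CakePartition k)

/-- In the partition `x` the guest prefers some piece of positive length. -/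
def PrefersPositivePiece {k : ℕ} (A : Preferences k) (x : CakePartition k) : Prop :=
  ∃ j : Fin k, 0 < x.1 j ∧ x ∈ A j

/-- A hungry guest: in every partition the guest prefers some piece of positive length. -/
def IsHungry {k : ℕ} (A : Preferences k) : Prop :=
  ∀ x : CakePartition k, PrefersPositivePiece A x

/-- The `n` guests with preferences `P` are `α`-hungry (used for `α ≤ n`): in every partition, among
any `n - α + 1` of the guests at least one prefers a piece of positive length; and the preferences of
every guest are closed. -/
def AreHungry {n k : ℕ} (α : ℕ) (P : Fin n → Preferences k) : Prop :=
  (∀ (x : CakePartition k) (C : Finset (Fin n)), C.card = n - α + 1 →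
      ∃ i ∈ C, PrefersPositivePiece (P i) x) ∧
    ∀ (i : Fin n) (j : Fin k), IsClosed (P i j)

/-- The preferences of all `n` guests, from the preferences `P` of all guests other than `alice` and
the preferences `A` of `alice`. -/
def withAlice {n k : ℕ} (alice : Fin n) (P : {i : Fin n // i ≠ alice} → Preferences k)
    (A : Preferences k) : Fin n → Preferences k :=
  fun i => if h : i = alice then A else P ⟨i, h⟩

/-- Giving, for each `j`, the `j`-th piece of `x` to the guest `π j` is an envy-free distribution of
the `k` pieces to `k` different guests: each of these guests receives one of their favorite pieces. -/
def IsEnvyFree {n k : ℕ} (P : Fin n → Preferences k) (x : CakePartition k)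
    (π : Fin k → Fin n) : Prop :=
  Function.Injective π ∧ ∀ j : Fin k, x ∈ P (π j) j

end SecretCake

/-! It suffices to find `x`, from the other guests' preferences alone, such that for every `j` the
pieces other than `j` can be given to distinct other guests who prefer them: Alice then takes `j`.

Up to an error `r`, let guest `i` spread a total weight of at most 1 over the pieces that `i` nearly
prefers, continuously in `x`, giving nothing to empty pieces, with all guests together spending at
least `k - 1` (`exists_weights`). The weight received by piece `l` vanishes where `x l = 0`, so a
Sperner argument yields an `x` at which all pieces receive the same weight `a ≥ (k - 1) / k`. If `S`
is a set of at most `k - 1` pieces, its neighbours spend at least `|S| * a > |S| - 1` on it, so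
there are at least `|S|` of them, and Hall's theorem applies. Compactness and closedness allow `r →
0`.

Sperner's lemma is derived from Scarf's lemma, applied to a fine net of the simplex with coordinates
as utilities; Scarf's lemma is a parity count of doors. -/

/-- A finite set on which every element has a unique partner under a symmetric, irreflexive relation
has even cardinality. -/
theorem Finset.natCast_card_eq_zero_of_existsUnique {α : Type*} (D : Finset α)
    (R : α → α → Prop) (hsymm : ∀ p q, R p q → R q p) (hirr : ∀ p, ¬ R p p)
    (hex : ∀ p ∈ D, ∃ q ∈ D, R p q)
    (huniq : ∀ p ∈ D, ∀ q ∈ D, ∀ q' ∈ D, R p q → R p q' → q = q') :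
    (D.card : ZMod 2) = 0 := by
  choose g hgD hgR using hex
  rw [Finset.cast_card]
  refine Finset.sum_involution g (fun _ _ => by decide) (fun a ha _ h => ?_) hgD (fun a ha => ?_)
  · have := hgR a ha
    rw [h] at this
    exact hirr a this
  · exact huniq (g a ha) (hgD a ha) _ (hgD _ _) a ha (hgR _ _) (hsymm _ _ (hgR a ha))

namespace SecretCake

/-! ### Scarf's lemma: rooms, doors and pivots -/

section Scarf

variable {I V L : Type*} [LinearOrder L]

/-- Given utilities `u i : V → L`, a room selects for each `i` an element `s i`, such that `s i` is
the worst of the selected elements for `u i`, and no element of `V` beats `s i` for every `i`. -/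
structure IsRoom (u : I → V → L) (s : I → V) : Prop where
  lt : ∀ i j, j ≠ i → u i (s i) < u i (s j)
  dom : ∀ v, ∃ i, u i v ≤ u i (s i)

/-- Removing the element `s a` of the room `s` leaves exactly the colours other than `z`. -/
def IsDoor (c : V → I) (z : I) (s : I → V) (a : I) : Prop :=
  (∀ j, j ≠ a → c (s j) ≠ z) ∧ ∀ i, i ≠ z → ∃ j, j ≠ a ∧ c (s j) = i

/-- The rooms `p.1` and `q.1` become equal, as sets, once the elements of index `p.2` and `q.2` are
removed from them. -/
def IsPivot (p q : (I → V) × I) : Prop :=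
  p.2 ≠ q.2 ∧ q.1 p.2 = p.1 q.2 ∧ ∀ j, j ≠ p.2 → j ≠ q.2 → q.1 j = p.1 j

theorem IsPivot.symm {p q : (I → V) × I} (h : IsPivot p q) : IsPivot q p :=
  ⟨h.1.symm, h.2.1.symm, fun j hq hp => (h.2.2 j hp hq).symm⟩

variable {u : I → V → L} {s : I → V}

theorem IsRoom.injective (hs : IsRoom u s) : Function.Injective s := by
  intro i j h
  by_contra hij
  have := hs.lt i j (Ne.symm hij)
  rw [h] at this
  exact lt_irrefl _ this

theorem IsRoom.le (hs : IsRoom u s) (i j : I) : u i (s i) ≤ u i (s j) := by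
  rcases eq_or_ne j i with rfl | h
  · exact le_rfl
  · exact (hs.lt i j h).le

/-- Two rooms that agree outside `b` are equal. -/
theorem IsRoom.eq_of_eqOn (hu : ∀ i, Function.Injective (u i)) {s' : I → V} (hs : IsRoom u s)
    (hs' : IsRoom u s') (b : I) (h : ∀ j, j ≠ b → s j = s' j) : s = s' := by
  have key : ∀ t t' : I → V, IsRoom u t → IsRoom u t' → (∀ j, j ≠ b → t j = t' j) →
      u b (t b) ≤ u b (t' b) := by
    intro t t' ht ht' h
    obtain ⟨i, hi⟩ := ht'.dom (t b)
    rcases eq_or_ne i b with rfl | hib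
    · exact hi
    · rw [← h i hib] at hi
      exact absurd hi (not_le.2 (ht.lt i b hib.symm))
  funext j
  rcases eq_or_ne j b with rfl | hj
  · exact hu j (le_antisymm (key s s' hs hs' h) (key s' s hs' hs fun j hj => (h j hj).symm))
  · exact h j hj

/-- The new room has `s b` at index `a`, so `s b` must be the worst for `u a` among the elements
left after removing `s a`. This fixes `b`, and then the rooms agree outside `b`. -/
theorem IsPivot.unique (hu : ∀ i, Function.Injective (u i)) {p q q' : (I → V) × I}
    (hp : IsRoom u p.1) (hq : IsRoom u q.1) (hq' : IsRoom u q'.1) (h : IsPivot p q)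
    (h' : IsPivot p q') : q = q' := by
  obtain ⟨s, a⟩ := p
  obtain ⟨t, b⟩ := q
  obtain ⟨t', b'⟩ := q'
  obtain ⟨hab, h1, h2⟩ := h
  obtain ⟨hab', h1', h2'⟩ := h'
  dsimp only at *
  have key : ∀ (t : I → V) (b b' : I), IsRoom u t → a ≠ b → t a = s b →
      (∀ j, j ≠ a → j ≠ b → t j = s j) → a ≠ b' → u a (s b) ≤ u a (s b') := by
    intro t b b' ht hab h1 h2 hab'
    rcases eq_or_ne b' b with rfl | hb
    · exact le_rfl
    · rw [← h1, ← h2 b' hab'.symm hb]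
      exact ht.le a b'
  have hb : b = b' := hp.injective (hu a (le_antisymm (key t b b' hq hab h1 h2 hab')
    (key t' b' b hq' hab' h1' h2' hab)))
  subst hb
  have : t = t' := hq.eq_of_eqOn hu hq' b (fun j hj => by
    rcases eq_or_ne j a with rfl | hja
    · rw [h1, h1']
    · rw [h2 j hja hj, h2' j hja hj])
  rw [this]

/-- A door depends only on the set of elements left after the removal, and a pivot preserves this
set. -/
theorem IsDoor.of_isPivot {c : V → I} {z : I} {p q : (I → V) × I} (h : IsPivot p q)
    (hp : IsDoor c z p.1 p.2) : IsDoor c z q.1 q.2 := by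
  obtain ⟨s, a⟩ := p
  obtain ⟨t, b⟩ := q
  obtain ⟨hab, h1, h2⟩ := h
  dsimp only at *
  refine ⟨fun j hj => ?_, fun i hi => ?_⟩
  · rcases eq_or_ne j a with rfl | hja
    · rw [h1]
      exact hp.1 b hab.symm
    · rw [h2 j hja hj]
      exact hp.1 j hja
  · obtain ⟨j, hj, hji⟩ := hp.2 i hi
    rcases eq_or_ne j b with rfl | hjb
    · exact ⟨a, hab, by rw [h1, hji]⟩
    · exact ⟨j, hjb, by rw [h2 j hj hjb, hji]⟩

/-- A room can be left through any door, except for the doors consisting of dummies. -/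
theorem IsRoom.exists_isPivot [Fintype I] [Fintype V] (hu : ∀ i, Function.Injective (u i)) {e : I → V}
    (he : ∀ i v, u i (e i) ≤ u i v)
    (hd : ∀ i j v, i ≠ j → u i (e j) ≤ u i v → v ∈ Set.range e) (hs : IsRoom u s) (a : I)
    (ha : ∃ j, j ≠ a ∧ s j ≠ e j) : ∃ q : (I → V) × I, IsRoom u q.1 ∧ IsPivot (s, a) q := by
  classical
  obtain ⟨m, hma, hm⟩ := ha
  obtain ⟨b, hb, hbmin⟩ := Finset.exists_min_image (Finset.univ.erase a) (fun j => u a (s j))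
    ⟨m, by simpa using hma⟩
  have hba : b ≠ a := by simpa using hb
  replace hbmin : ∀ j, j ≠ a → u a (s b) ≤ u a (s j) := fun j hj => hbmin j (by simpa using hj)
  have hself : ∀ j k, s j = e k → j = k := by
    intro j k h
    by_contra hjk
    have h1 := hs.lt k j hjk
    rw [h] at h1
    exact absurd h1 (not_lt.2 (he k _))
  -- The element `s b` takes over index `a`. The elements of `M` respect all requirements except
  -- that of `b`; the best of them for `u b` fills index `b`.
  let M : Finset V := {w | (∀ j, j ≠ a → j ≠ b → u j (s j) < u j w) ∧ u a (s b) < u a w}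
  have hM : M.Nonempty := by
    by_contra hM
    -- If even `e b` fails a threshold, everything left in the room is at least as good as `e b` for
    -- some utility other than `u b`, hence a dummy.
    have hebM : e b ∉ M := fun h => hM ⟨_, h⟩
    have hdum : ∀ j, j ≠ a → s j ∈ Set.range e := by
      by_cases h : ∃ j, j ≠ a ∧ j ≠ b ∧ u j (e b) ≤ u j (s j)
      · obtain ⟨j, -, hjb, hj⟩ := h
        exact fun i _ => hd j b _ hjb (hj.trans (hs.le j i))
      · push Not at h
        have h' : u a (e b) ≤ u a (s b) := by
          by_contra hlt
          exact hebM (by simpa [M] using ⟨h, not_le.1 hlt⟩)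
        exact fun i hi => hd a b _ hba.symm (h'.trans (hbmin i hi))
    obtain ⟨k, hk⟩ := hdum m hma
    have := hself m k hk.symm
    subst this
    exact hm hk.symm
  obtain ⟨y, hyM, hymax⟩ := Finset.exists_max_image M (u b) hM
  obtain ⟨hy1, hy2⟩ : (∀ j, j ≠ a → j ≠ b → u j (s j) < u j y) ∧ u a (s b) < u a y := by
    simpa [M] using hyM
  have hyb : u b y < u b (s b) := by
    obtain ⟨i, hi⟩ := hs.dom y
    have hib : i = b := by
      by_contra hib
      rcases eq_or_ne i a with rfl | hia
      · exact absurd (hi.trans (hs.le i b)) (not_le.2 hy2)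
      · exact absurd hi (not_le.2 (hy1 i hia hib))
    subst hib
    refine lt_of_le_of_ne hi fun h => ?_
    rw [hu i h] at hy2
    exact lt_irrefl _ hy2
  let t : I → V := Function.update (Function.update s a (s b)) b y
  have tb : t b = y := by simp [t]
  have ta : t a = s b := by simp [t, Function.update_of_ne hba.symm]
  have tj : ∀ j, j ≠ a → j ≠ b → t j = s j := fun j h1 h2 => by
    simp [t, Function.update_of_ne h2, Function.update_of_ne h1]
  refine ⟨(t, b), ⟨fun i j hji => ?_, fun w => ?_⟩, hba.symm, ta, tj⟩
  · dsimp only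
    rcases eq_or_ne i a with rfl | hia
    · rw [ta]
      rcases eq_or_ne j b with rfl | hjb
      · rwa [tb]
      · rw [tj j hji hjb]
        exact lt_of_le_of_ne (hbmin j hji) fun h => hjb (hs.injective (hu i h)).symm
    · rcases eq_or_ne i b with rfl | hib
      · rw [tb]
        rcases eq_or_ne j a with rfl | hja
        · rwa [ta]
        · rw [tj j hja hji]
          exact hyb.trans_le (hs.le i j)
      · rw [tj i hia hib]
        rcases eq_or_ne j b with rfl | hjb
        · rw [tb]
          exact hy1 i hia hib
        · rcases eq_or_ne j a with rfl | hja
          · rw [ta]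
            exact hs.lt i b (Ne.symm hib)
          · rw [tj j hja hjb]
            exact hs.lt i j hji
  · by_contra! h
    dsimp only at h
    have hwM : w ∈ M := by
      simp only [M, Finset.mem_filter, Finset.mem_univ, true_and]
      exact ⟨fun j h1 h2 => by simpa [tj j h1 h2] using h j, by simpa [ta] using h a⟩
    exact absurd (hymax w hwM) (not_le.2 (by simpa [tb] using h b))

/-- There is a unique room containing all the dummies but `e z`. -/
theorem exists_isRoom_dummies [Fintype V] (hu : ∀ i, Function.Injective (u i)) {e : I → V}
    (he : ∀ i v, u i (e i) ≤ u i v) (hei : Function.Injective e)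
    (hd : ∀ i j v, i ≠ j → u i (e j) ≤ u i v → v ∈ Set.range e) (z : I) :
    ∃ s, IsRoom u s ∧ ∀ j, j ≠ z → s j = e j := by
  classical
  have he' : ∀ i v, v ≠ e i → u i (e i) < u i v := fun i v hv =>
    lt_of_le_of_ne (he i v) fun h => hv (hu i h).symm
  let M : Finset V := {w | ∀ j, j ≠ z → u j (e j) < u j w}
  have hez : e z ∈ M := by
    simp only [M, Finset.mem_filter, Finset.mem_univ, true_and]
    exact fun j hj => he' j _ fun h => hj (hei h).symm
  obtain ⟨y, hyM, hymax⟩ := Finset.exists_max_image M (u z) ⟨_, hez⟩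
  replace hyM : ∀ j, j ≠ z → u j (e j) < u j y := by simpa [M] using hyM
  have hyz : ∀ j, j ≠ z → u z y < u z (e j) := by
    intro j hj
    by_contra hle
    obtain ⟨m, rfl⟩ := hd z j y hj.symm (not_lt.1 hle)
    rcases eq_or_ne m z with rfl | hm
    · exact hle (he' m _ fun h => hj (hei h))
    · exact lt_irrefl _ (hyM m hm)
  have tz : Function.update e z y z = y := by simp
  have tj : ∀ j, j ≠ z → Function.update e z y j = e j := fun j hj => Function.update_of_ne hj _ _
  refine ⟨Function.update e z y, ⟨fun i j hji => ?_, fun w => ?_⟩, tj⟩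
  · rcases eq_or_ne i z with rfl | hiz
    · rw [tz, tj j hji]
      exact hyz j hji
    · rw [tj i hiz]
      rcases eq_or_ne j z with rfl | hjz
      · rw [tz]
        exact hyM i hiz
      · rw [tj j hjz]
        exact he' i _ fun h => hji (hei h)
  · by_contra! h
    have hw : w ∈ M := by
      simp only [M, Finset.mem_filter, Finset.mem_univ, true_and]
      exact fun j hj => by simpa [tj j hj] using h j
    exact absurd (hymax w hw) (not_le.2 (by simpa [tz] using h z))

/-- The pivot of a room containing all the dummies but `e z` does not exist. -/
theorem not_isPivot_dummies {e : I → V} (he : ∀ i v, u i (e i) ≤ u i v)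
    (hd : ∀ i j v, i ≠ j → u i (e j) ≤ u i v → v ∈ Set.range e) {z : I} {p q : (I → V) × I}
    (hp : IsRoom u p.1) (hqz : q.2 = z) (hq : ∀ j, j ≠ z → q.1 j = e j) : ¬ IsPivot p q := by
  rintro ⟨hab, h1, h2⟩
  obtain ⟨s, a⟩ := p
  obtain ⟨t, b⟩ := q
  dsimp only at *
  subst hqz
  have hsb : s b = e a := by rw [← h1, hq a hab]
  have hlt := hp.lt b a hab
  rw [hsb] at hlt
  obtain ⟨m, hm⟩ := hd b a _ hab.symm hlt.le
  rcases eq_or_ne m b with rfl | hmb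
  · rw [← hm] at hlt
    exact absurd hlt (not_lt.2 (he m _))
  · rcases eq_or_ne m a with rfl | hma
    · rw [← hm] at hlt
      exact lt_irrefl _ hlt
    · have : s m = s a := by rw [← h2 m hma hmb, hq m hmb, hm]
      exact hma (hp.injective this)

/-- In a room that does not have all colours, each door has exactly one companion. -/
theorem IsDoor.exists_other {c : V → I} {z : I} {a : I} (h : IsDoor c z s a)
    (hns : ¬ Function.Surjective (c ∘ s)) : ∃ b, b ≠ a ∧ IsDoor c z s b := by
  have haz : c (s a) ≠ z := by
    intro haz
    refine hns fun i => ?_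
    rcases eq_or_ne i z with rfl | hi
    · exact ⟨a, haz⟩
    · obtain ⟨j, -, hj⟩ := h.2 i hi
      exact ⟨j, hj⟩
  obtain ⟨b, hb, hbc⟩ := h.2 _ haz
  refine ⟨b, hb, fun j hj => ?_, fun i hi => ?_⟩
  · rcases eq_or_ne j a with rfl | hja
    · exact haz
    · exact h.1 j hja
  · obtain ⟨j, hj, hji⟩ := h.2 i hi
    rcases eq_or_ne j b with rfl | hjb
    · exact ⟨a, hb.symm, by rw [← hbc, hji]⟩
    · exact ⟨j, hjb, hji⟩

theorem IsDoor.injOn [Fintype I] {c : V → I} {z : I} {a : I} (h : IsDoor c z s a) {i j : I} (hi : i ≠ a)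
    (hj : j ≠ a) (hij : c (s i) = c (s j)) : i = j := by
  classical
  have := Finset.injOn_of_surjOn_of_card_le (s := Finset.univ.erase a) (t := Finset.univ.erase z)
    (c ∘ s) (fun x hx => by simpa using h.1 x (by simpa using hx))
    (fun x hx => by
      obtain ⟨j, hj, hjx⟩ := h.2 x (by simpa using hx)
      exact ⟨j, by simpa using hj, hjx⟩)
    (by simp [Finset.card_erase_of_mem])
  exact this (by simpa using hi) (by simpa using hj) hij

theorem IsDoor.other_unique [Fintype I] {c : V → I} {z : I} {a b b' : I} (h : IsDoor c z s a)
    (hb : IsDoor c z s b) (hb' : IsDoor c z s b') (hba : b ≠ a) (hba' : b' ≠ a) : b = b' := by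
  obtain ⟨d, hda, hd⟩ := h.2 (c (s a)) (hb.1 a hba.symm)
  have key : ∀ b, b ≠ a → IsDoor c z s b → b = d := by
    intro b hba hb
    by_contra hbd
    exact hda (hb.injOn (Ne.symm hbd) hba.symm hd)
  rw [key b hba hb, key b' hba' hb']

/-- **Scarf's lemma**: there is a room with all colours. -/
theorem exists_isRoom_surjective [Fintype I] [Fintype V] [Nonempty I]
    (hu : ∀ i, Function.Injective (u i)) {e : I → V}
    (he : ∀ i v, u i (e i) ≤ u i v)
    (hd : ∀ i j v, i ≠ j → u i (e j) ≤ u i v → v ∈ Set.range e) (c : V → I)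
    (hc : ∀ i, c (e i) = i) : ∃ s, IsRoom u s ∧ Function.Surjective (c ∘ s) := by
  classical
  by_contra! hno
  obtain ⟨z⟩ := ‹Nonempty I›
  have hei : Function.Injective e := fun i j h => by rw [← hc i, h, hc j]
  obtain ⟨t, ht, hte⟩ := exists_isRoom_dummies hu he hei hd z
  let D : Finset ((I → V) × I) := {p | IsRoom u p.1 ∧ IsDoor c z p.1 p.2}
  have hD : ∀ p, p ∈ D ↔ IsRoom u p.1 ∧ IsDoor c z p.1 p.2 := fun p => by simp [D]
  have htD : (t, z) ∈ D := by
    rw [hD]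
    refine ⟨ht, fun j hj => ?_, fun i hi => ⟨i, hi, ?_⟩⟩
    · dsimp only at hj ⊢
      rwa [hte j hj, hc]
    · dsimp only
      rw [hte i hi, hc]
  -- Without a fully coloured room, doors come in pairs within each room.
  have hEven : (D.card : ZMod 2) = 0 := by
    refine Finset.natCast_card_eq_zero_of_existsUnique D (fun p q => p.1 = q.1 ∧ q.2 ≠ p.2)
      (fun p q h => ⟨h.1.symm, h.2.symm⟩) (fun p h => h.2 rfl) (fun p hp => ?_) ?_
    · obtain ⟨hp1, hp2⟩ := (hD p).1 hp
      obtain ⟨b, hb, hb'⟩ := hp2.exists_other (hno _ hp1)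
      exact ⟨(p.1, b), (hD _).2 ⟨hp1, hb'⟩, rfl, hb⟩
    · rintro ⟨s, a⟩ hp ⟨s1, b⟩ hq ⟨s2, b'⟩ hq' ⟨h1, h2⟩ ⟨h3, h4⟩
      dsimp only at h1 h2 h3 h4
      subst h1 h3
      exact Prod.ext rfl
        (((hD _).1 hp).2.other_unique ((hD _).1 hq).2 ((hD _).1 hq').2 h2 h4)
  -- Pivoting pairs all doors except the one consisting of dummies.
  have hOdd : ((D.erase (t, z)).card : ZMod 2) = 0 := by
    refine Finset.natCast_card_eq_zero_of_existsUnique _ IsPivot (fun p q h => h.symm)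
      (fun p h => h.1 rfl) (fun p hp => ?_) ?_
    · obtain ⟨hpne, hpD⟩ := Finset.mem_erase.1 hp
      obtain ⟨hp1, hp2⟩ := (hD p).1 hpD
      have hex : ∃ j, j ≠ p.2 ∧ p.1 j ≠ e j := by
        by_contra! hall
        have haz : p.2 = z := by
          by_contra hne
          exact hp2.1 z (Ne.symm hne) (by rw [hall z (Ne.symm hne), hc])
        apply hpne
        refine Prod.ext (hp1.eq_of_eqOn hu ht z fun j hj => ?_) haz
        rw [hall j (haz ▸ hj)]
        exact (hte j hj).symm
      obtain ⟨q, hq, hpq⟩ := hp1.exists_isPivot hu he hd p.2 hex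
      refine ⟨q, Finset.mem_erase.2 ⟨?_, (hD q).2 ⟨hq, hp2.of_isPivot hpq⟩⟩, hpq⟩
      rintro rfl
      exact not_isPivot_dummies he hd hp1 rfl hte hpq
    · intro p hp q hq q' hq' h h'
      exact h.unique hu ((hD _).1 (Finset.mem_of_mem_erase hp)).1
        ((hD _).1 (Finset.mem_of_mem_erase hq)).1 ((hD _).1 (Finset.mem_of_mem_erase hq')).1 h'
  rw [← Finset.card_erase_add_one htD, Nat.cast_add, hOdd] at hEven
  exact absurd hEven (by decide)

end Scarf

/-! ### Sperner's lemma and equalizing functions on the simplex -/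

variable {I : Type*} [Fintype I]

/-- A form of **Sperner's lemma**: if the points of the simplex are coloured with its vertices, then
some point `z` has points of colour `i` arbitrarily close to it for every `i` with `z i ≠ 0`. -/
theorem exists_forall_eq_zero_or_exists_dist_lt [Nonempty I] (c : stdSimplex ℝ I → I) {ε : ℝ}
    (hε : 0 < ε) :
    ∃ z : stdSimplex ℝ I, ∀ i, z.1 i = 0 ∨ ∃ x, dist x z < ε ∧ c x = i := by
  classical
  have hk : (0 : ℝ) < Fintype.card I := by exact_mod_cast Fintype.card_pos
  set δ : ℝ := ε / Fintype.card I with hδ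
  have hδ0 : 0 < δ := div_pos hε hk
  have hcard : (Fintype.card I : ℝ) * δ = ε := by rw [hδ]; field_simp
  obtain ⟨t, -, htfin, ht⟩ :=
    finite_cover_balls_of_compact (isCompact_univ (X := stdSimplex ℝ I)) hδ0
  have := htfin.fintype
  -- Coordinates lie in `[0,1]`, so `-1` puts dummy `i` below everything for `i`, and `2` puts the
  -- other dummies above all net points. Ties are broken by `idx`.
  let val : I → I ⊕ t → ℝ := fun i => Sum.elim (fun j => if j = i then -1 else 2) (fun x => x.1.1 i)
  let idx := Fintype.equivFin (I ⊕ t)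
  let u : I → I ⊕ t → ℝ ×ₗ Fin (Fintype.card (I ⊕ t)) := fun i v => toLex (val i v, idx v)
  have hu : ∀ i, Function.Injective (u i) := fun i v w h =>
    idx.injective (congrArg (fun p => (ofLex p).2) h)
  have uval : ∀ i v w, u i v ≤ u i w → val i v ≤ val i w := fun i v w h => by
    rcases Prod.Lex.le_iff.1 h with h | h
    · exact h.le
    · exact h.1.le
  have he : ∀ i v, u i (Sum.inl i) ≤ u i v := by
    intro i v
    rcases v with j | x
    · rcases eq_or_ne j i with rfl | h
      · exact le_rfl
      · refine Prod.Lex.le_iff.2 (Or.inl ?_)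
        simp [u, val, h]
        norm_num
    · refine Prod.Lex.le_iff.2 (Or.inl ?_)
      have := x.1.2.1 i
      simp only [u, val, ofLex_toLex, Sum.elim_inl, Sum.elim_inr, if_true]
      linarith
  have hd : ∀ i j v, i ≠ j → u i (Sum.inl j) ≤ u i v →
      v ∈ Set.range (Sum.inl : I → I ⊕ t) := by
    intro i j v hij h
    rcases v with m | x
    · exact ⟨m, rfl⟩
    · have h1 := uval i _ _ h
      have h2 : x.1.1 i ≤ 1 := (mem_Icc_of_mem_stdSimplex x.1.2 i).2
      simp only [val, Sum.elim_inl, Sum.elim_inr, if_neg hij.symm] at h1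
      linarith
  obtain ⟨s, hs, hcol⟩ := exists_isRoom_surjective hu he hd
    (Sum.elim id (fun x : t => c x.1)) (fun _ => rfl)
  have hself : ∀ j m, s j = Sum.inl m → j = m := by
    intro j m h
    by_contra hjm
    have h1 := hs.lt m j hjm
    rw [h] at h1
    exact absurd h1 (not_lt.2 (he m _))
  have hx : ∀ i, ∃ x : stdSimplex ℝ I, s i ≠ Sum.inl i → ∃ h : x ∈ t, s i = Sum.inr ⟨x, h⟩ := by
    intro i
    rcases h : s i with m | x
    · refine ⟨Classical.choice inferInstance, fun hne => ?_⟩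
      exact absurd (congrArg Sum.inl (hself i m h).symm) hne
    · exact ⟨x.1, fun _ => ⟨x.2, rfl⟩⟩
  choose x hx using hx
  let C : Finset I := {i | s i ≠ Sum.inl i}
  have hC : ∀ i, i ∈ C ↔ s i ≠ Sum.inl i := fun i => by simp [C]
  have hdom : ∀ y ∈ t, ∃ i ∈ C, y.1 i ≤ (x i).1 i := by
    intro y hy
    obtain ⟨i, hi⟩ := hs.dom (Sum.inr ⟨y, hy⟩)
    have hi' := uval i _ _ hi
    have hy0 := y.2.1 i
    by_cases h : s i = Sum.inl i
    · rw [h] at hi'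
      simp only [val, Sum.elim_inl, Sum.elim_inr, if_true] at hi'
      linarith
    · obtain ⟨h1, h2⟩ := hx i h
      rw [h2] at hi'
      exact ⟨i, (hC i).2 h, hi'⟩
  have hmin : ∀ i ∈ C, ∀ j ∈ C, (x i).1 i ≤ (x j).1 i := by
    intro i hi j hj
    obtain ⟨h1, h2⟩ := hx i ((hC i).1 hi)
    obtain ⟨h3, h4⟩ := hx j ((hC j).1 hj)
    have := uval i _ _ (hs.le i j)
    rw [h2, h4] at this
    exact this
  obtain ⟨j₀, hj₀⟩ : C.Nonempty := by
    obtain ⟨y, hy, -⟩ := Set.mem_iUnion₂.1 (ht (Set.mem_univ (Classical.choice inferInstance)))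
    obtain ⟨i, hi, -⟩ := hdom y hy
    exact ⟨i, hi⟩
  have hCpos : (1 : ℝ) ≤ C.card := by exact_mod_cast Finset.card_pos.2 ⟨j₀, hj₀⟩
  let w : I → ℝ := fun i => if i ∈ C then (x i).1 i else 0
  have hw0 : ∀ i, 0 ≤ w i := fun i => by
    by_cases h : i ∈ C
    · simpa [w, h] using (x i).2.1 i
    · simp [w, h]
  have hwx : ∀ j ∈ C, ∀ i, w i ≤ (x j).1 i := fun j hj i => by
    by_cases h : i ∈ C
    · simpa [w, h] using hmin i h j hj
    · simpa [w, h] using (x j).2.1 i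
  set g : ℝ := (1 - ∑ i, w i) / C.card with hg
  have hCg : C.card * g = 1 - ∑ i, w i := by rw [hg]; field_simp
  have hg0 : 0 ≤ g := by
    have : ∑ i, w i ≤ 1 := (x j₀).2.2 ▸ Finset.sum_le_sum fun i _ => hwx j₀ hj₀ i
    exact div_nonneg (by linarith) (by linarith)
  -- The lower bounds `w` leave the mass `C.card * g`, shared equally among the coordinates in `C`.
  let z : stdSimplex ℝ I := ⟨fun i => w i + if i ∈ C then g else 0, fun i => by
    have := hw0 i
    dsimp only
    split_ifs <;> linarith, by
    have h : ∑ i, (if i ∈ C then g else 0) = 1 - ∑ i, w i := by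
      rw [← hCg]
      simp
    rw [Finset.sum_add_distrib, h]
    ring⟩
  -- A net point `y` near `z` cannot beat the room, so `y i ≤ z i - g` for some `i ∈ C`.
  have hgδ : g < δ := by
    obtain ⟨y, hy, hzy⟩ := Set.mem_iUnion₂.1 (ht (Set.mem_univ z))
    obtain ⟨i, hi, hyi⟩ := hdom y hy
    have h1 : dist (z.1 i) (y.1 i) < δ := (dist_le_pi_dist z.1 y.1 i).trans_lt hzy
    have h2 : z.1 i = (x i).1 i + g := by simp [z, w, hi]
    rw [Real.dist_eq, h2] at h1
    linarith [le_abs_self ((x i).1 i + g - y.1 i)]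
  have hCgε : C.card * g < ε := by
    rw [← hcard]
    refine lt_of_le_of_lt (mul_le_mul_of_nonneg_right ?_ hg0) (mul_lt_mul_of_pos_left hgδ hk)
    exact_mod_cast Finset.card_le_univ C
  have hdist : ∀ j ∈ C, dist (x j) z < ε := by
    intro j hj
    refine lt_of_le_of_lt ?_ hCgε
    rw [Subtype.dist_eq]
    refine (dist_pi_le_iff (by positivity)).2 fun l => ?_
    have h1 : (x j).1 l - w l ≤ C.card * g := by
      have h : (x j).1 l - w l ≤ ∑ i, ((x j).1 i - w i) :=
        Finset.single_le_sum (f := fun i => (x j).1 i - w i)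
          (fun i _ => sub_nonneg.2 (hwx j hj i)) (Finset.mem_univ l)
      rwa [Finset.sum_sub_distrib, (x j).2.2, ← hCg] at h
    have h2 : w l ≤ z.1 l ∧ z.1 l ≤ w l + g := by
      dsimp only [z]
      split_ifs <;> constructor <;> linarith
    have h3 : g ≤ C.card * g := le_mul_of_one_le_left hg0 hCpos
    have h4 := hwx j hj l
    rw [Real.dist_eq, abs_le]
    constructor <;> linarith
  refine ⟨z, fun i => ?_⟩
  by_cases hi : i ∈ C
  · obtain ⟨j, hj⟩ := hcol i
    dsimp only [Function.comp_apply] at hj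
    have hjC : j ∈ C := by
      rw [hC]
      intro h
      rw [h] at hj
      exact (hC i).1 hi (by rw [← show j = i from hj, h])
    obtain ⟨h1, h2⟩ := hx j ((hC j).1 hjC)
    rw [h2] at hj
    exact Or.inr ⟨x j, hdist j hjC, hj⟩
  · left
    simp [z, w, hi]

/-- Continuous nonnegative functions `F i` on the simplex, with `F i` vanishing on the facet `x i = 0`,
are all equal at some point. -/
theorem exists_forall_eq_of_eq_zero [Nonempty I] (F : I → stdSimplex ℝ I → ℝ)
    (hF : ∀ i, Continuous (F i)) (hF0 : ∀ i x, 0 ≤ F i x) (hFz : ∀ i x, x.1 i = 0 → F i x = 0) :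
    ∃ x, ∀ i j, F i x = F j x := by
  have happ : ∀ ε > 0, ∃ z, ∀ i j, F i z ≤ F j z + ε := by
    intro ε hε
    have huc : UniformContinuous fun x i => F i x :=
      CompactSpace.uniformContinuous_of_continuous (continuous_pi hF)
    obtain ⟨η, hη, hη'⟩ := Metric.uniformContinuous_iff.1 huc (ε / 2) (half_pos hε)
    -- Colouring by an index of least value: near a point of colour `i`, `F i` is almost the
    -- smallest.
    choose c hc using fun x => Finite.exists_min (fun i => F i x)
    obtain ⟨z, hz⟩ := exists_forall_eq_zero_or_exists_dist_lt c hη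
    refine ⟨z, fun i j => ?_⟩
    rcases hz i with h | ⟨x, hx, rfl⟩
    · linarith [hFz i z h, hF0 j z]
    · have h : ∀ l, |F l x - F l z| < ε / 2 := fun l => by
        rw [← Real.dist_eq]
        exact (dist_le_pi_dist _ _ l).trans_lt (hη' hx)
      linarith [abs_lt.1 (h (c x)), abs_lt.1 (h j), hc x j]
  have hcont : Continuous fun x => ‖fun p : I × I => F p.1 x - F p.2 x‖ := by fun_prop
  obtain ⟨x, -, hx⟩ := isCompact_univ.exists_isMinOn Set.univ_nonempty hcont.continuousOn
  have h0 : ‖fun p : I × I => F p.1 x - F p.2 x‖ ≤ 0 := by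
    refine le_of_forall_pos_le_add fun ε hε => ?_
    obtain ⟨z, hz⟩ := happ ε hε
    refine (hx (Set.mem_univ z)).trans ?_
    rw [zero_add]
    refine (pi_norm_le_iff_of_nonneg hε.le).2 fun p => ?_
    rw [Real.norm_eq_abs, abs_le]
    constructor <;> linarith [hz p.1 p.2, hz p.2 p.1]
  refine ⟨x, fun i j => ?_⟩
  exact sub_eq_zero.1 (congrFun (norm_le_zero_iff.1 h0) (i, j))

/-! ### Continuous weights, Hall's theorem and passage to the limit -/

variable {k : ℕ} {G : Type*} [Fintype G]

/-- Weights `f i l` of the piece `l` for the guest `i`, depending continuously on the partition, such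
that the weights of a guest sum up to at most one, and the weights of all guests to at least `k - 1`. -/
theorem exists_weights (P : G → Preferences k)
    (hpos : ∀ x, k ≤ {i | PrefersPositivePiece (P i) x}.ncard + 1) {r : ℝ} (hr : 0 < r) :
    ∃ f : G → Fin k → CakePartition k → ℝ, (∀ i l, Continuous (f i l)) ∧ (∀ i l x, 0 ≤ f i l x) ∧
      (∀ i l x, x.1 l = 0 → f i l x = 0) ∧
      (∀ i l x, f i l x ≠ 0 → x ∈ Metric.thickening r (P i l)) ∧
      (∀ i x, ∑ l, f i l x ≤ 1) ∧ ∀ x, (k : ℝ) ≤ ∑ i, ∑ l, f i l x + 1 := by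
  classical
  -- The factor `x.1 l` makes the weight vanish on empty pieces and bounds the total of a guest by
  -- 1.
  let g : G → Fin k → CakePartition k → ℝ := fun i l x =>
    x.1 l * (thickenedIndicator hr (P i l) x : ℝ)
  have hgc : ∀ i l, Continuous (g i l) := fun i l =>
    ((continuous_apply l).comp continuous_subtype_val).mul
      (NNReal.continuous_coe.comp (thickenedIndicator hr (P i l)).continuous)
  have hg0 : ∀ i l x, 0 ≤ g i l x := fun i l x => mul_nonneg (x.2.1 l) (NNReal.coe_nonneg _)
  have hgle : ∀ i l x, g i l x ≤ x.1 l := fun i l x =>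
    mul_le_of_le_one_right (x.2.1 l) (by exact_mod_cast thickenedIndicator_le_one hr (P i l) x)
  let h : G → CakePartition k → ℝ := fun i x => ∑ l, g i l x
  have hhc : ∀ i, Continuous (h i) := fun i => continuous_finsetSum _ fun l _ => hgc i l
  have hh0 : ∀ i x, 0 ≤ h i x := fun i x => Finset.sum_nonneg fun l _ => hg0 i l x
  have hh1 : ∀ i x, h i x ≤ 1 := fun i x =>
    (Finset.sum_le_sum fun l _ => hgle i l x).trans_eq x.2.2
  have hhpos : ∀ i x, PrefersPositivePiece (P i) x → 0 < h i x := by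
    rintro i x ⟨l, hl, hxl⟩
    refine lt_of_lt_of_le ?_ (Finset.single_le_sum (fun l _ => hg0 i l x) (Finset.mem_univ l))
    dsimp only [g]
    rw [thickenedIndicator_one hr _ hxl]
    simpa using hl
  let 𝒞 : Finset (Finset G) := {C | Fintype.card G + 2 ≤ C.card + k}
  have h𝒞 : ∀ C, C ∈ 𝒞 ↔ Fintype.card G + 2 ≤ C.card + k := fun C => by simp [𝒞]
  -- Each set in `𝒞` is too large to consist of guests preferring no piece of positive length, so
  -- every factor is positive. The factors are at most 1, so `δ` is below each of these averages.
  let δ : CakePartition k → ℝ := fun x => ∏ C ∈ 𝒞, (∑ i ∈ C, h i x) / C.card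
  have hδc : Continuous δ := continuous_finsetProd _ fun C _ =>
    (continuous_finsetSum _ fun i _ => hhc i).div_const _
  have hδpos : ∀ x, 0 < δ x := by
    refine fun x => Finset.prod_pos fun C hC => ?_
    have : ∃ i ∈ C, PrefersPositivePiece (P i) x := by
      by_contra! hno
      have h1 := hpos x
      have h2 : {i | PrefersPositivePiece (P i) x}.ncard ≤ Cᶜ.card := by
        rw [← Set.ncard_coe_finset]
        exact Set.ncard_le_ncard (fun i hi => by
          simp only [Finset.coe_compl, Set.mem_compl_iff, Finset.mem_coe]
          exact fun hiC => hno i hiC hi)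
      have h3 := Finset.card_add_card_compl C
      have h4 := (h𝒞 C).1 hC
      omega
    obtain ⟨i, hi, hix⟩ := this
    refine div_pos ?_ (by exact_mod_cast Finset.card_pos.2 ⟨i, hi⟩)
    exact lt_of_lt_of_le (hhpos i x hix) (Finset.single_le_sum (fun i _ => hh0 i x) hi)
  have hδle : ∀ x, ∀ C ∈ 𝒞, δ x ≤ (∑ i ∈ C, h i x) / C.card := by
    intro x C hC
    have h0 : ∀ C : Finset G, 0 ≤ (∑ i ∈ C, h i x) / C.card := fun C =>
      div_nonneg (Finset.sum_nonneg fun i _ => hh0 i x) (Nat.cast_nonneg _)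
    have h1 : ∀ C : Finset G, (∑ i ∈ C, h i x) / C.card ≤ 1 := fun C => by
      refine div_le_one_of_le₀ ?_ (Nat.cast_nonneg _)
      simpa using Finset.sum_le_card_nsmul C (fun i => h i x) 1 fun i _ => hh1 i x
    dsimp only [δ]
    rw [← Finset.mul_prod_erase _ _ hC]
    exact mul_le_of_le_one_right (h0 C) (Finset.prod_le_one (fun C _ => h0 C) fun C _ => h1 C)
  have hm : ∀ i x, 0 < max (h i x) (δ x) := fun i x => lt_max_of_lt_right (hδpos x)
  have hsum : ∀ i x, ∑ l, g i l x / max (h i x) (δ x) = h i x / max (h i x) (δ x) := fun i x => by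
    rw [← Finset.sum_div]
  refine ⟨fun i l x => g i l x / max (h i x) (δ x),
    fun i l => (hgc i l).div ((hhc i).max hδc) fun x => (hm i x).ne',
    fun i l x => div_nonneg (hg0 i l x) (hm i x).le, fun i l x hx => ?_, fun i l x hx => ?_,
    fun i x => ?_, fun x => ?_⟩
  · simp [g, hx]
  · by_contra hxl
    refine hx ?_
    dsimp only [g]
    rw [thickenedIndicator_zero hr _ hxl, NNReal.coe_zero, mul_zero, zero_div]
  · rw [hsum]
    exact div_le_one_of_le₀ (le_max_left _ _) (hm i x).le
  · simp only [hsum]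
    let B : Finset G := {i | h i x < δ x}
    -- The average of `h` over `B` would be below `δ`. So `B` is small, and at least `k - 1` guests
    -- outside it spend exactly 1.
    have hB : B ∉ 𝒞 := by
      intro hB
      have h1 := hδle x B hB
      rcases B.eq_empty_or_nonempty with h0 | hne
      · rw [h0] at h1
        simp only [Finset.sum_empty, zero_div] at h1
        exact absurd h1 (not_le.2 (hδpos x))
      · have h3 : (∑ i ∈ B, h i x) < ∑ i ∈ B, δ x :=
          Finset.sum_lt_sum_of_nonempty hne fun i hi => by simpa [B] using hi
        rw [le_div_iff₀ (by exact_mod_cast hne.card_pos)] at h1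
        rw [Finset.sum_const, nsmul_eq_mul] at h3
        linarith
    have h1 : (Bᶜ.card : ℝ) ≤ ∑ i, h i x / max (h i x) (δ x) := by
      have : ∑ i ∈ Bᶜ, h i x / max (h i x) (δ x) = Bᶜ.card := by
        rw [Finset.card_eq_sum_ones, Nat.cast_sum]
        refine Finset.sum_congr rfl fun i hi => ?_
        have hi' : δ x ≤ h i x := by simpa [B] using hi
        rw [max_eq_left hi', Nat.cast_one, div_self ((hδpos x).trans_le hi').ne']
      rw [← this]
      exact Finset.sum_le_sum_of_subset_of_nonneg (Finset.subset_univ _) fun i _ _ =>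
        div_nonneg (hh0 i x) (hm i x).le
    have h2 : k ≤ Bᶜ.card + 1 := by
      have := Finset.card_add_card_compl B
      rw [h𝒞] at hB
      omega
    have h3 : (k : ℝ) ≤ Bᶜ.card + 1 := by exact_mod_cast h2
    linarith

/-- For some partition, whichever piece is removed, the remaining pieces can be distributed so that
everybody who receives a piece is within `r` of preferring it. -/
theorem exists_forall_exists_mem_thickening (hk : 1 ≤ k) (P : G → Preferences k)
    (hpos : ∀ x, k ≤ {i | PrefersPositivePiece (P i) x}.ncard + 1) {r : ℝ} (hr : 0 < r) :
    ∃ x : CakePartition k, ∀ j, ∃ π : {l : Fin k // l ≠ j} → G, Function.Injective π ∧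
      ∀ l, x ∈ Metric.thickening r (P (π l) l) := by
  classical
  obtain ⟨f, hfc, hf0, hfz, hfP, hf1, hfk⟩ := exists_weights P hpos hr
  have : Nonempty (Fin k) := ⟨⟨0, hk⟩⟩
  obtain ⟨x, hx⟩ := exists_forall_eq_of_eq_zero (fun l x => ∑ i, f i l x)
    (fun l => continuous_finsetSum _ fun i _ => hfc i l)
    (fun l x => Finset.sum_nonneg fun i _ => hf0 i l x)
    (fun l x h => Finset.sum_eq_zero fun i _ => hfz i l x h)
  refine ⟨x, fun j => ?_⟩
  let t : {l : Fin k // l ≠ j} → Finset G := fun l => {i | f i l x ≠ 0}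
  obtain ⟨π, hπ, hπt⟩ := (Finset.all_card_le_biUnion_card_iff_exists_injective t).1 (fun S => by
    set a : ℝ := ∑ i, f i j x with ha
    set N := S.biUnion t
    have hka : (k : ℝ) * a = ∑ i, ∑ l, f i l x := by
      rw [Finset.sum_comm, Finset.sum_congr rfl fun l _ => hx l j]
      simp [ha]
    have hSa : (S.card : ℝ) * a ≤ N.card := by
      calc (S.card : ℝ) * a = ∑ l ∈ S, ∑ i, f i l x := by
            rw [Finset.sum_congr rfl fun l _ => hx l.1 j]
            simp [ha]
        _ = ∑ l ∈ S, ∑ i ∈ N, f i l x := by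
            refine Finset.sum_congr rfl fun l hl => ?_
            refine (Finset.sum_subset (Finset.subset_univ N) fun i _ hi => ?_).symm
            by_contra hne
            exact hi (Finset.mem_biUnion.2 ⟨l, hl, by simpa [t] using hne⟩)
        _ = ∑ i ∈ N, ∑ l ∈ S, f i l x := Finset.sum_comm
        _ ≤ ∑ i ∈ N, 1 := by
            refine Finset.sum_le_sum fun i _ => le_trans ?_ (hf1 i x)
            refine (Finset.sum_map S (Function.Embedding.subtype _)
              fun l => f i l x).symm.trans_le ?_
            exact Finset.sum_le_sum_of_subset_of_nonneg (Finset.subset_univ _)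
              fun l _ _ => hf0 i l x
        _ = N.card := by simp
    have hS : S.card + 1 ≤ k := by
      have h1 := Finset.card_le_univ S
      rw [Fintype.card_subtype_compl, Fintype.card_fin, Fintype.card_subtype_eq] at h1
      omega
    have hS' : (S.card : ℝ) + 1 ≤ k := by exact_mod_cast hS
    have hk' : (k : ℝ) ≤ k * a + 1 := hka ▸ hfk x
    -- Otherwise `|S| * (k - 1) ≤ k * |S| * a ≤ k * (|S| - 1)`, which forces `k ≤ |S|`.
    by_contra! hlt
    have hlt' : (N.card : ℝ) + 1 ≤ S.card := by exact_mod_cast hlt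
    have hS0 : (0 : ℝ) ≤ S.card := Nat.cast_nonneg _
    have hk0 : (0 : ℝ) < k := by exact_mod_cast hk
    have h1 : (S.card : ℝ) * (k - 1) ≤ S.card * (k * a) :=
      mul_le_mul_of_nonneg_left (by linarith) hS0
    have h2 : (k : ℝ) * (S.card * a) ≤ k * (S.card - 1) :=
      mul_le_mul_of_nonneg_left (by linarith) hk0.le
    linarith)
  exact ⟨π, hπ, fun l => hfP _ _ _ (by simpa [t] using hπt l)⟩

/-- For some partition, whichever piece is removed, the remaining pieces can be distributed to
guests who prefer them. -/
theorem exists_forall_exists_mem (hk : 1 ≤ k) (P : G → Preferences k)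
    (hcl : ∀ i l, IsClosed (P i l))
    (hpos : ∀ x, k ≤ {i | PrefersPositivePiece (P i) x}.ncard + 1) :
    ∃ x : CakePartition k, ∀ j, ∃ π : {l : Fin k // l ≠ j} → G, Function.Injective π ∧
      ∀ l, x ∈ P (π l) l := by
  have hr : ∀ n : ℕ, (0 : ℝ) < 1 / (n + 1) := fun n => Nat.one_div_pos_of_nat
  choose y hy using fun n : ℕ => exists_forall_exists_mem_thickening hk P hpos (hr n)
  obtain ⟨x, φ, hφ, hlim⟩ := CompactSpace.tendsto_subseq y
  have hev : ∀ i l, x ∉ P i l →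
      ∀ᶠ n in Filter.atTop, y (φ n) ∉ Metric.thickening (1 / ((φ n : ℝ) + 1)) (P i l) := by
    intro i l hx
    obtain ⟨ε, hε, hεx⟩ := Metric.isOpen_iff.1 (hcl i l).isOpen_compl x hx
    have h1 : ∀ᶠ n in Filter.atTop, dist (y (φ n)) x < ε / 2 :=
      hlim (Metric.ball_mem_nhds x (half_pos hε))
    have h2 : ∀ᶠ n in Filter.atTop, (1 / ((φ n : ℝ) + 1)) < ε / 2 :=
      (tendsto_one_div_add_atTop_nhds_zero_nat.comp hφ.tendsto_atTop).eventually_lt_const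
        (half_pos hε)
    filter_upwards [h1, h2] with n h1 h2 h3
    obtain ⟨z, hz, hzd⟩ := Metric.mem_thickening_iff.1 h3
    refine hεx (Metric.mem_ball.2 ?_) hz
    linarith [dist_triangle_left z x (y (φ n))]
  -- There are finitely many pairs `(i, l)`, so one `n` excludes every non-preference at `x`; any
  -- distribution valid for `y (φ n)` is then valid for `x`.
  obtain ⟨n, hn⟩ := (Filter.eventually_all.2 fun i => Filter.eventually_all.2 fun l =>
    Filter.eventually_imp_distrib_left.2 (hev i l)).exists
  refine ⟨x, fun j => ?_⟩
  obtain ⟨π, hπ, hπy⟩ := hy (φ n) j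
  refine ⟨π, hπ, fun l => ?_⟩
  by_contra hx
  exact hn _ _ hx (hπy l)

end SecretCake

/-! ### Bringing in Alice -/

/-- The partition `x` is chosen from the preferences `P` of the other guests alone, before the secret
preferences `A` of Alice are revealed. -/
theorem theorem1p2 (n k : ℕ) (hk : 1 ≤ k) (hkn : k ≤ n) (alice : Fin n)
    (P : {i : Fin n // i ≠ alice} → SecretCake.Preferences k) :
    ∃ x : SecretCake.CakePartition k,
      ∀ A : SecretCake.Preferences k,
        SecretCake.IsHungry A →
        SecretCake.AreHungry k (SecretCake.withAlice alice P A) →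
        ∀ j : Fin k, x ∈ A j →
          ∃ π : Fin k → Fin n,
            SecretCake.IsEnvyFree (SecretCake.withAlice alice P A) x π ∧ π j = alice := by
  classical
  have hP : ∀ A i, SecretCake.withAlice alice P A (i : {i // i ≠ alice}).1 = P i :=
    fun A i => by simp [SecretCake.withAlice, i.2]
  -- If no Alice makes the guests `k`-hungry, any `x` will do. Otherwise one such `A₀` serves only
  -- to extract properties of `P`, so `x` does not depend on the actual `A`.
  by_cases hex : ∃ A, SecretCake.AreHungry k (SecretCake.withAlice alice P A)
  swap
  · have : Nonempty (Fin k) := ⟨⟨0, hk⟩⟩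
    exact ⟨Classical.choice inferInstance, fun A _ hA => absurd ⟨A, hA⟩ hex⟩
  obtain ⟨A₀, hpos, hcl⟩ := hex
  obtain ⟨x, hx⟩ := SecretCake.exists_forall_exists_mem hk P (fun i l => hP A₀ i ▸ hcl i.1 l)
    (fun x => by
      by_contra! hlt
      let S : Finset {i : Fin n // i ≠ alice} := {i | SecretCake.PrefersPositivePiece (P i) x}
      have hS : {i | SecretCake.PrefersPositivePiece (P i) x}.ncard = S.card := by
        rw [← Set.ncard_coe_finset]
        simp [S]
      have hcard : Fintype.card {i : Fin n // i ≠ alice} = n - 1 := by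
        rw [Fintype.card_subtype_compl, Fintype.card_fin, Fintype.card_subtype_eq]
      have hc := Finset.card_add_card_compl S
      -- With fewer than `k - 1` of the `n - 1` others preferring a piece of positive length, `n - k
      -- + 1` of them would violate hunger, without involving Alice.
      obtain ⟨C, hCS, hC⟩ := Finset.exists_subset_card_eq (s := Sᶜ) (n := n - k + 1) (by omega)
      obtain ⟨i, hi, hix⟩ := hpos x (C.map (Function.Embedding.subtype _)) (by simpa using hC)
      obtain ⟨i, hiC, rfl⟩ := Finset.mem_map.1 hi
      have hiS : i ∉ S := by simpa using hCS hiC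
      rw [Function.Embedding.subtype_apply, hP] at hix
      exact hiS (by simpa [S] using hix))
  refine ⟨x, fun A _ _ j hj => ?_⟩
  obtain ⟨π, hπ, hπx⟩ := hx j
  refine ⟨fun l => if h : l = j then alice else (π ⟨l, h⟩).1, ⟨fun a b hab => ?_, fun l => ?_⟩,
    by simp⟩
  · dsimp only at hab
    split_ifs at hab with ha hb hb
    · rw [ha, hb]
    · exact absurd hab.symm (π _).2
    · exact absurd hab (π _).2
    · exact congrArg Subtype.val (hπ (Subtype.ext hab))
  · dsimp only
    split_ifs with hl
    · subst hl
      simpa [SecretCake.withAlice] using hj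
    · rw [hP]
      exact hπx ⟨l, hl⟩
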